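/- Let $X$ be an infinite-dimensional complex Banach space and let $T$ be a bounded linear operator on $X$. Write $N(S)$ and $R(S)$ for the null space and the range of an operator $S$. A bounded operator $S$ on a Banach space $Y$ is called Fredholm if $\dim N(S)<\infty$ and $R(S)$ is closed with $\dim Y/R(S)<\infty$; its index is $\dim N(S)-\dim Y/R(S)$, and $S$ is called Weyl if it is Fredholm of index $0$. A bounded operator $S$ on $X$ is called B-Weyl if for some integer $n\ge 0$ the range $R(S^n)$ is closed and the restriction $S_{[n]}:R(S^n)\to R(S^n)$ of $S$ is Weyl. Let $\sigma(T)$ be the spectrum of $T$, and put \[\sigma_W(T)=\{\lambda\in\mathbb{C}: T-\lambda I\text{ is not Weyl}\},\qquad \sigma_{BW}(T)=\{\lambda\in\mathbb{C}: T-\lambda I\text{ is not B-Weyl}\}.\] Let $\sigma_a(T)$ be the approximate point spectrum, i.e. the set of $\lambda\in\mathbb{C}$ such that for every $\varepsilon>0$ there is $x\in X$ with $\|x\|=1$ and $\|(T-\lambda I)x\|<\varepsilon$. Let $E_a(T)$ be the set of isolated points of $\sigma_a(T)$ that are eigenvalues of $T$, and $E_a^0(T)$ the set of those $\lambda\in E_a(T)$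 for which $\dim N(T-\lambda I)<\infty$. Then the following statements are equivalent: (i) $T$ has property $(Z_{E_a})$, i.e. $\sigma(T)\setminus\sigma_W(T)=E_a(T)$; (ii) $T$ has property $(gaw)$, i.e. $\sigma(T)\setminus\sigma_{BW}(T)=E_a(T)$, and $\sigma_{BW}(T)=\sigma_W(T)$; (iii) $T$ has property $(aw)$, i.e. $\sigma(T)\setminus\sigma_W(T)=E_a^0(T)$, and $E_a(T)=E_a^0(T)$; (iv) $T$ has property $(Baw)$, i.e. $\sigma(T)\setminus\sigma_{BW}(T)=E_a^0(T)$, and $E_a(T)=E_a^0(T)$. -/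

import Mathlib

noncomputable section

namespace WeylType

variable {X : Type*} [NormedAddCommGroup X] [NormedSpace ℂ X]

/-- The operator `T - lam I`. -/
def shift (T : X →L[ℂ] X) (lam : ℂ) : X →L[ℂ] X :=
  T - lam • ContinuousLinearMap.id ℂ X

/-- A Weyl operator: a Fredholm operator (finite-dimensional kernel, closed range of finite
codimension) of index `0`, where the index is `dim ker T - codim range T`. -/
def IsWeyl (T : X →L[ℂ] X) : Prop :=
  T.IsFredholm ∧ T.toLinearMap.index = 0

theorem mapsTo_range_pow (T : X →L[ℂ] X) (n : ℕ) :
    Set.MapsTo T ((T ^ n).range : Set X) ((T ^ n).range : Set X) := by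
  rintro _ ⟨y, rfl⟩
  refine ⟨T y, ?_⟩
  change (T ^ n * T) y = (T * T ^ n) y
  rw [← pow_succ, ← pow_succ']

/-- The restriction `T_[n] : R(T ^ n) → R(T ^ n)` of `T` to the range of `T ^ n`. -/
def restrictRange (T : X →L[ℂ] X) (n : ℕ) : (T ^ n).range →L[ℂ] (T ^ n).range :=
  T.restrict (mapsTo_range_pow T n)

/-- `T` is B-Weyl if for some `n ≥ 0` the range of `T ^ n` is closed and the restriction of `T`
to that range is a Weyl operator. -/
def IsBWeyl (T : X →L[ℂ] X) : Prop :=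
  ∃ n : ℕ, IsClosed ((T ^ n).range : Set X) ∧ IsWeyl (restrictRange T n)

/-- The Weyl spectrum. -/
def weylSpectrum (T : X →L[ℂ] X) : Set ℂ := {lam | ¬ IsWeyl (shift T lam)}

/-- The B-Weyl spectrum. -/
def bWeylSpectrum (T : X →L[ℂ] X) : Set ℂ := {lam | ¬ IsBWeyl (shift T lam)}

/-- The approximate point spectrum: those `lam` for which there are unit vectors `x` with
`(T - lam I) x` arbitrarily small. -/
def approxPointSpectrum (T : X →L[ℂ] X) : Set ℂ :=
  {lam | ∀ ε : ℝ, 0 < ε → ∃ x : X, ‖x‖ = 1 ∧ ‖shift T lam x‖ < ε}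

/-- The eigenvalues of `T`. -/
def pointSpectrum (T : X →L[ℂ] X) : Set ℂ :=
  {lam | ∃ x : X, x ≠ 0 ∧ T x = lam • x}

/-- The eigenvalues of `T` of finite multiplicity, i.e. with finite-dimensional `N(T - lam I)`. -/
def finitePointSpectrum (T : X →L[ℂ] X) : Set ℂ :=
  {lam | lam ∈ pointSpectrum T ∧ FiniteDimensional ℂ (shift T lam).ker}

/-- The isolated points of a subset of `ℂ`. -/
def iso (A : Set ℂ) : Set ℂ := A \ derivedSet A

/-- `E_a(T)`. -/
def Ea (T : X →L[ℂ] X) : Set ℂ := iso (approxPointSpectrum T) ∩ pointSpectrum T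

/-- `E_a^0(T)`. -/
def Ea0 (T : X →L[ℂ] X) : Set ℂ := iso (approxPointSpectrum T) ∩ finitePointSpectrum T

/-- Property `(Z_{E_a})`. -/
def PropertyZEa (T : X →L[ℂ] X) : Prop := spectrum ℂ T \ weylSpectrum T = Ea T

/-- Property `(gaw)`. -/
def PropertyGaw (T : X →L[ℂ] X) : Prop := spectrum ℂ T \ bWeylSpectrum T = Ea T

/-- Property `(aw)`. -/
def PropertyAw (T : X →L[ℂ] X) : Prop := spectrum ℂ T \ weylSpectrum T = Ea0 T

/-- Property `(Baw)`. -/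
def PropertyBaw (T : X →L[ℂ] X) : Prop := spectrum ℂ T \ bWeylSpectrum T = Ea0 T

end WeylType

end

/-! Statement (i) is the hub: once `bWeylSpectrum T = weylSpectrum T` or `Ea T = Ea0 T` is known,
the rest is substitution. The substance is that (i) forces both equalities, and that (iv) gives back
(i).

Let `l` be a spectral point with `T - l` B-Weyl. It is an eigenvalue, because an injective B-Weyl
operator is bijective. By `eventually_of_isBWeyl_shift`, a punctured neighbourhood of `l` lies
either in the resolvent set or among the eigenvalues outside the Weyl spectrum. Under (i) the second
case would fill that neighbourhood with isolated points of the approximate point spectrum, which is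
absurd. In the first case `l` lies in `Ea T`, hence outside the Weyl spectrum. For (iv), a B-Weyl
operator with finite-dimensional kernel is Weyl, by additivity of the index.

The dichotomy reduces to the zeros of an analytic determinant: a Weyl `f` is a finite rank
perturbation of a bijection, so near `0` the kernel and cokernel of `f - a` are those of a matrix
analytic in `a`. -/

open Filter Topology

namespace WeylType

/-! ### Transfer of kernels and cokernels along intertwining maps -/

section Algebra

variable {k E F : Type*} [Field k] [AddCommGroup E] [Module k E] [AddCommGroup F] [Module k F]

/-- Two endomorphisms `f` and `g` intertwined by injective maps `i` and `j` have isomorphic kernels,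
provided the kernel of `f` lies in the range of `j`. -/
theorem nonempty_ker_equiv {f : E →ₗ[k] E} {g : F →ₗ[k] F} {i j : F →ₗ[k] E}
    (hi : Function.Injective i) (hj : Function.Injective j) (hc : ∀ x, i (g x) = f (j x))
    (hk : ∀ x, f x = 0 → ∃ y, j y = x) : Nonempty (g.ker ≃ₗ[k] f.ker) := by
  refine ⟨LinearEquiv.ofBijective (j.restrict (p := g.ker) (q := f.ker) ?_) ⟨?_, ?_⟩⟩
  · intro x hx
    rw [LinearMap.mem_ker] at hx ⊢
    rw [← hc, hx, map_zero]
  · intro x y hxy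
    exact Subtype.ext (hj (congrArg Subtype.val hxy))
  · rintro ⟨x, hx⟩
    obtain ⟨y, rfl⟩ := hk x hx
    refine ⟨⟨y, hi ?_⟩, rfl⟩
    rw [hc, map_zero]
    exact hx

/-- Two endomorphisms `f` and `g` intertwined by maps `i` and `j` have isomorphic cokernels,
provided the range of `i` is a supplement of the range of `f` and `i` reflects ranges. -/
theorem nonempty_coker_equiv {f : E →ₗ[k] E} {g : F →ₗ[k] F} {i j : F →ₗ[k] E}
    (hc : ∀ x, i (g x) = f (j x)) (hs : ∀ x, ∃ y z, i y + f z = x)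
    (hr : ∀ y x, f x = i y → ∃ z, g z = y) :
    Nonempty ((F ⧸ g.range) ≃ₗ[k] (E ⧸ f.range)) := by
  have hle : g.range ≤ f.range.comap i := by
    rintro _ ⟨x, rfl⟩
    exact ⟨j x, (hc x).symm⟩
  refine ⟨LinearEquiv.ofBijective (g.range.mapQ f.range i hle) ⟨?_, ?_⟩⟩
  · rw [← LinearMap.ker_eq_bot, LinearMap.ker_eq_bot']
    intro q hq
    obtain ⟨y, rfl⟩ := Submodule.Quotient.mk_surjective _ q
    rw [Submodule.mapQ_apply, Submodule.Quotient.mk_eq_zero] at hq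
    obtain ⟨x, hx⟩ := hq
    rw [Submodule.Quotient.mk_eq_zero]
    exact hr y x hx
  · intro q
    obtain ⟨x, rfl⟩ := Submodule.Quotient.mk_surjective _ q
    obtain ⟨y, z, rfl⟩ := hs x
    refine ⟨Submodule.Quotient.mk y, ?_⟩
    rw [Submodule.mapQ_apply, Submodule.Quotient.eq]
    exact ⟨-z, by simp⟩

end Algebra

/-! ### Weyl operators described by linear algebra -/

section Fredholm

variable {X : Type*} [NormedAddCommGroup X] [NormedSpace ℂ X]

/-- Closed range is automatic: `f` is injective on a closed complement `E` of its kernel and has the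
same range there, and that range has a finite-dimensional, hence closed, algebraic complement. -/
theorem isFredholm_of_finite [CompleteSpace X] (f : X →L[ℂ] X) [FiniteDimensional ℂ f.ker]
    [FiniteDimensional ℂ (X ⧸ f.range)] : f.IsFredholm := by
  obtain ⟨E, hEc, hE⟩ :=
    (Submodule.ClosedComplemented.of_finiteDimensional f.ker).exists_isClosed_isCompl
  obtain ⟨G, hG⟩ := f.range.exists_isCompl
  have : CompleteSpace E := hEc.completeSpace_coe
  have : FiniteDimensional ℂ G :=
    Module.Finite.equiv (Submodule.quotientEquivOfIsCompl _ _ hG)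
  have hker : (f.comp E.subtypeL).ker = ⊥ := by
    rw [LinearMap.ker_eq_bot']
    intro x hx
    have : (x : X) ∈ f.ker ⊓ E := ⟨hx, x.2⟩
    rw [hE.inf_eq_bot] at this
    exact Subtype.ext ((Submodule.mem_bot ℂ).1 this)
  have hsurj : ∀ y, ∃ x : E, f x = f y := by
    intro y
    have : y ∈ f.ker ⊔ E := by rw [hE.sup_eq_top]; trivial
    obtain ⟨a, ha, b, hb, rfl⟩ := Submodule.mem_sup.1 this
    refine ⟨⟨b, hb⟩, ?_⟩
    rw [map_add, show f a = 0 from ha, zero_add]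
  have hrange : (f.comp E.subtypeL).range = f.range := by
    ext y
    constructor
    · rintro ⟨x, rfl⟩
      exact ⟨x, rfl⟩
    · rintro ⟨x, rfl⟩
      obtain ⟨z, hz⟩ := hsurj x
      exact ⟨z, hz⟩
  have hclosed : IsClosed (f.range : Set X) := by
    rw [← hrange]
    exact (f.comp E.subtypeL).closed_complemented_range_of_isCompl_of_ker_eq_bot G
      (hrange ▸ hG) (Submodule.closed_of_finiteDimensional G) hker
  have : CompleteSpace f.range := hclosed.completeSpace_coe
  have : E.CoFG := by
    have : Module.Finite ℂ (X ⧸ E) :=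
      Module.Finite.equiv (Submodule.quotientEquivOfIsCompl _ _ hE.symm).symm
    exact this
  have : f.range.CoFG := ‹FiniteDimensional ℂ (X ⧸ f.range)›
  have hmaps : Set.MapsTo f E f.range := fun x _ => ⟨x, rfl⟩
  refine .of_isInvertible_restrict hEc hclosed hmaps
    ⟨.ofBijective (f.restrict hmaps) ?_ ?_, ContinuousLinearMap.ext fun _ => rfl⟩
  · rw [LinearMap.ker_eq_bot']
    intro x hx
    exact (LinearMap.ker_eq_bot'.1 hker) x (congrArg Subtype.val hx)
  · rw [LinearMap.range_eq_top]
    rintro ⟨_, y, rfl⟩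
    obtain ⟨x, hx⟩ := hsurj y
    exact ⟨x, Subtype.ext hx⟩

/-- With topology gone from the condition, it can be carried along merely linear isomorphisms of
kernels and cokernels. -/
theorem isWeyl_iff [CompleteSpace X] {f : X →L[ℂ] X} :
    IsWeyl f ↔ FiniteDimensional ℂ f.ker ∧ FiniteDimensional ℂ (X ⧸ f.range) ∧
      Module.finrank ℂ f.ker = Module.finrank ℂ (X ⧸ f.range) := by
  constructor
  · rintro ⟨h, hi⟩
    refine ⟨h.finite_ker, h.finite_coker, ?_⟩
    rw [LinearMap.index_eq_finrank_sub] at hi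
    lia
  · rintro ⟨_, _, hi⟩
    refine ⟨isFredholm_of_finite f, ?_⟩
    rw [LinearMap.index_eq_finrank_sub]
    lia

theorem IsWeyl.bijective_of_injective [CompleteSpace X] {f : X →L[ℂ] X} (hf : IsWeyl f)
    (hi : Function.Injective f) : Function.Bijective f := by
  obtain ⟨_, _, h⟩ := isWeyl_iff.1 hf
  refine ⟨hi, ?_⟩
  have hk : f.ker = ⊥ := LinearMap.ker_eq_bot.2 hi
  rw [hk, finrank_bot] at h
  have := Module.finrank_zero_iff.1 h.symm
  exact LinearMap.range_eq_top.1 (Submodule.Quotient.subsingleton_iff.1 this)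

theorem isWeyl_of_bijective [CompleteSpace X] {f : X →L[ℂ] X} (hf : Function.Bijective f) :
    IsWeyl f := by
  have hk : f.ker = ⊥ := LinearMap.ker_eq_bot.2 hf.1
  have hr : f.range = ⊤ := LinearMap.range_eq_top.2 hf.2
  have : Subsingleton (X ⧸ f.range) := Submodule.Quotient.subsingleton_iff.2 hr
  rw [isWeyl_iff, hk]
  refine ⟨inferInstance, inferInstance, ?_⟩
  rw [finrank_bot, Module.finrank_zero_of_subsingleton]

/-- Kernel and cokernel conditions under which the Weyl property and injectivity pass
between two operators intertwined by injective maps. -/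
theorem isWeyl_congr [CompleteSpace X] {Y : Type*} [NormedAddCommGroup Y] [NormedSpace ℂ Y]
    [CompleteSpace Y] {f : X →L[ℂ] X} {g : Y →L[ℂ] Y} {i j : Y →ₗ[ℂ] X}
    (hi : Function.Injective i) (hj : Function.Injective j) (hc : ∀ x, i (g x) = f (j x))
    (hk : ∀ x, f x = 0 → ∃ y, j y = x) (hs : ∀ x, ∃ y z, i y + f z = x)
    (hr : ∀ y x, f x = i y → ∃ z, g z = y) :
    (IsWeyl f ↔ IsWeyl g) ∧ (Function.Injective f ↔ Function.Injective g) := by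
  obtain ⟨e⟩ := nonempty_ker_equiv (f := f.toLinearMap) (g := g.toLinearMap) hi hj hc hk
  obtain ⟨e'⟩ := nonempty_coker_equiv (f := f.toLinearMap) (g := g.toLinearMap) hc hs hr
  constructor
  · rw [isWeyl_iff, isWeyl_iff, e.finrank_eq, e'.finrank_eq]
    refine and_congr ⟨fun h => .equiv e.symm, fun h => .equiv e⟩
      (and_congr_left fun _ => ⟨fun h => .equiv e'.symm, fun h => .equiv e'⟩)
  · constructor
    · intro h x y hxy
      apply hj; apply h; rw [← hc, ← hc, hxy]
    · intro h
      rw [injective_iff_map_eq_zero]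
      intro x hx
      obtain ⟨y, rfl⟩ := hk x hx
      have : g y = g 0 := by
        apply hi
        rw [hc, hx, map_zero, map_zero]
      rw [h this, map_zero]

end Fredholm

/-! ### Small translates of a Weyl operator -/

section Perturbation

variable {X : Type*} [NormedAddCommGroup X] [NormedSpace ℂ X]

theorem shift_apply (f : X →L[ℂ] X) (a : ℂ) (x : X) : shift f a x = f x - a • x := rfl

/-- A Weyl operator is a finite rank perturbation of a bijective operator. -/
theorem IsWeyl.exists_bijective_add [CompleteSpace X] {f : X →L[ℂ] X} (hf : IsWeyl f) :
    ∃ (P : X →L[ℂ] f.ker) (J : f.ker →L[ℂ] X),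
      Function.Injective J ∧ Function.Bijective (f + J.comp P) := by
  obtain ⟨_, _, h⟩ := isWeyl_iff.1 hf
  obtain ⟨P, hP⟩ := Submodule.ClosedComplemented.of_finiteDimensional f.ker
  obtain ⟨G, hG⟩ := f.range.exists_isCompl
  have e := Submodule.quotientEquivOfIsCompl _ _ hG
  have : FiniteDimensional ℂ G := Module.Finite.equiv e
  -- Index zero is used here: the kernel has the dimension of a complement `G` of the range, so `f`
  -- is repaired by sending the kernel onto `G`.
  let j : f.ker ≃ₗ[ℂ] G := LinearEquiv.ofFinrankEq _ _ (h.trans e.finrank_eq)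
  refine ⟨P, G.subtypeL.comp j.toLinearMap.toContinuousLinearMap, ?_, ?_, ?_⟩
  · exact G.subtype_injective.comp j.injective
  · rw [injective_iff_map_eq_zero]
    intro x hx
    have hx' : f x + (j (P x) : X) = 0 := hx
    have hmem : f x ∈ f.range ⊓ G := by
      refine ⟨⟨x, rfl⟩, ?_⟩
      rw [eq_neg_of_add_eq_zero_left hx']
      exact G.neg_mem (j (P x)).2
    rw [hG.inf_eq_bot] at hmem
    have h0 : f x = 0 := (Submodule.mem_bot ℂ).1 hmem
    rw [h0, zero_add] at hx'
    have : P x = 0 := j.injective (by rw [map_zero]; exact Subtype.ext hx')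
    rw [hP ⟨x, h0⟩] at this
    exact congrArg Subtype.val this
  · intro y
    have hy : y ∈ f.range ⊔ G := by rw [hG.sup_eq_top]; trivial
    obtain ⟨_, ⟨x, rfl⟩, w, hw, rfl⟩ := Submodule.mem_sup.1 hy
    -- The kernel component of `x` is replaced by the one that `j` sends to `w`; this leaves `f x`
    -- unchanged.
    refine ⟨x - P x + j.symm ⟨w, hw⟩, ?_⟩
    have h1 : f (P x : X) = 0 := (P x).2
    have h2 : f (j.symm ⟨w, hw⟩ : X) = 0 := (j.symm ⟨w, hw⟩).2
    have h3 : P (x - P x + j.symm ⟨w, hw⟩) = j.symm ⟨w, hw⟩ := by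
      rw [map_add, map_sub, hP, hP, sub_self, zero_add]
    change f (x - P x + j.symm ⟨w, hw⟩) + (j (P (x - P x + j.symm ⟨w, hw⟩)) : X) = f x + w
    rw [h3, map_add, map_sub, h1, h2, j.apply_symm_apply, sub_zero, add_zero]

theorem isWeyl_of_finiteDimensional [FiniteDimensional ℂ X] (f : X →L[ℂ] X) : IsWeyl f := by
  have : CompleteSpace X := FiniteDimensional.complete ℂ X
  refine isWeyl_iff.2 ⟨inferInstance, inferInstance, ?_⟩
  have h1 := f.toLinearMap.finrank_range_add_finrank_ker
  have h2 := f.range.finrank_quotient_add_finrank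
  lia

/-- By the Leibniz formula the determinant is a polynomial in the matrix entries, each a continuous
linear function of `M a`. -/
theorem analyticAt_det {V : Type*} [NormedAddCommGroup V] [NormedSpace ℂ V]
    [FiniteDimensional ℂ V] {M : ℂ → V →L[ℂ] V} {z : ℂ} (hM : AnalyticAt ℂ M z) :
    AnalyticAt ℂ (fun a => LinearMap.det (M a).toLinearMap) z := by
  let b := Module.finBasis ℂ V
  have heq : (fun a => LinearMap.det (M a).toLinearMap) = fun a =>
      ∑ σ : Equiv.Perm (Fin (Module.finrank ℂ V)), ((Equiv.Perm.sign σ : ℤ) : ℂ) *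
        ∏ i, (b.coord (σ i)).toContinuousLinearMap (M a (b i)) := by
    funext a
    rw [← LinearMap.det_toMatrix b, Matrix.det_apply']
    simp only [LinearMap.toMatrix_apply]
    rfl
  rw [heq]
  refine Finset.analyticAt_fun_sum _ fun σ _ => analyticAt_const.mul ?_
  refine Finset.analyticAt_fun_prod _ fun i _ => ?_
  exact ((b.coord (σ i)).toContinuousLinearMap.analyticAt _).comp
    (((ContinuousLinearMap.apply ℂ V (b i)).analyticAt _).comp hM)

/-- Near a Weyl operator, the small nonzero translates are either all bijective or all
Weyl and not injective. -/
theorem IsWeyl.eventually_shift [CompleteSpace X] {f : X →L[ℂ] X} (hf : IsWeyl f) :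
    (∀ᶠ a in 𝓝[≠] (0 : ℂ), Function.Bijective (shift f a)) ∨
      ∀ᶠ a in 𝓝[≠] (0 : ℂ), IsWeyl (shift f a) ∧ ¬ Function.Injective (shift f a) := by
  obtain ⟨_, _, _⟩ := isWeyl_iff.1 hf
  obtain ⟨P, J, hJ, hB⟩ := hf.exists_bijective_add
  set B : X →L[ℂ] X := f + J.comp P with hBdef
  obtain ⟨u, hu⟩ := ContinuousLinearMap.isUnit_iff_bijective.2 hB
  let R : ℂ → X →L[ℂ] X := fun a => B - a • 1
  have hR0 : R 0 = u := by simp [R, hu]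
  have hR : AnalyticAt ℂ R 0 := analyticAt_const.sub (analyticAt_id.smul analyticAt_const)
  have hG : AnalyticAt ℂ (fun a => Ring.inverse (R a)) 0 := by
    have := analyticAt_inverse (𝕜 := ℂ) u
    rw [← hR0] at this
    exact this.comp hR
  let M : ℂ → f.ker →L[ℂ] f.ker := fun a => 1 - P.comp ((Ring.inverse (R a)).comp J)
  have hM : AnalyticAt ℂ M 0 := by
    refine analyticAt_const.sub ?_
    exact ((ContinuousLinearMap.compL ℂ f.ker X f.ker P).analyticAt _).comp
      ((((ContinuousLinearMap.compL ℂ f.ker X X).flip J).analyticAt _).comp hG)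
  have hunit : ∀ᶠ a in 𝓝[≠] (0 : ℂ), IsUnit (R a) := by
    refine Filter.Eventually.filter_mono nhdsWithin_le_nhds ?_
    refine hR.continuousAt.eventually ?_
    rw [hR0]
    exact Units.isOpen.mem_nhds u.isUnit
  have key : ∀ a, IsUnit (R a) → IsWeyl (shift f a) ∧
      (Function.Injective (shift f a) ↔ LinearMap.det (M a).toLinearMap ≠ 0) := by
    intro a ha
    have hl : ∀ x, Ring.inverse (R a) (R a x) = x := fun x =>
      DFunLike.congr_fun (Ring.inverse_mul_cancel _ ha) x
    have hr : ∀ x, R a (Ring.inverse (R a) x) = x := fun x =>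
      DFunLike.congr_fun (Ring.mul_inverse_cancel _ ha) x
    have hs : ∀ x, shift f a x = R a x - J (P x) := by
      intro x
      change f x - a • x = f x + J (P x) - a • x - J (P x)
      abel
    have hMa : ∀ v, M a v = v - P (Ring.inverse (R a) (J v)) := fun v => rfl
    -- Here `f - a = R - JP` with `R = R a` invertible, and `J M = (R - JP) R⁻¹ J`. The kernel of `R
    -- - JP` lies in the range of `R⁻¹ J`, and `x = J P R⁻¹ x + (R - JP) R⁻¹ x` gives the
    -- supplement.
    have := isWeyl_congr (f := shift f a) (g := M a) (i := J.toLinearMap)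
      (j := ((Ring.inverse (R a)).comp J).toLinearMap) hJ
      (fun x y hxy => hJ ?_) (fun x => ?_) (fun x hx => ⟨P x, ?_⟩)
      (fun x => ⟨P (Ring.inverse (R a) x), Ring.inverse (R a) x, ?_⟩)
      (fun y x hx => ⟨y + P x, ?_⟩)
    · refine ⟨this.1.2 (isWeyl_of_finiteDimensional _), this.2.trans ?_⟩
      rw [← isUnit_iff_ne_zero, ← LinearMap.isUnit_iff_isUnit_det, Module.End.isUnit_iff]
      exact ⟨fun h => ⟨h, LinearMap.surjective_of_injective h⟩, fun h => h.1⟩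
    · have := congrArg (R a) hxy
      exact (hr _).symm.trans (this.trans (hr _))
    · change J (M a x) = shift f a (Ring.inverse (R a) (J x))
      rw [hs, hr, hMa, map_sub]
    · change Ring.inverse (R a) (J (P x)) = x
      rw [hs, sub_eq_zero] at hx
      rw [← hx, hl]
    · change J _ + shift f a _ = x
      rw [hs, hr]
      abel
    · change shift f a x = J y at hx
      have hx' : Ring.inverse (R a) (J (y + P x)) = x := by
        rw [map_add, ← hx, hs, sub_add_cancel, hl]
      rw [hMa, hx']
      abel
  -- Zeros of an analytic function are isolated unless it vanishes near the point.
  rcases (analyticAt_det hM).eventually_eq_zero_or_eventually_ne_zero with h | h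
  · right
    filter_upwards [h.filter_mono nhdsWithin_le_nhds, hunit] with a ha hu
    exact ⟨(key a hu).1, fun hi => (key a hu).2.1 hi ha⟩
  · left
    filter_upwards [h, hunit] with a ha hu
    exact (key a hu).1.bijective_of_injective ((key a hu).2.2 ha)

end Perturbation

/-! ### B-Weyl operators and restriction to the range of a power -/

section RestrictRange

variable {X : Type*} [NormedAddCommGroup X] [NormedSpace ℂ X]

theorem shift_shift (f : X →L[ℂ] X) (a b : ℂ) : shift (shift f a) b = shift f (a + b) := by
  ext x
  simp only [shift_apply, add_smul, sub_sub]

theorem pow_apply_comm (f : X →L[ℂ] X) (n : ℕ) (x : X) : (f ^ n) (f x) = f ((f ^ n) x) := by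
  change (f ^ n * f) x = (f * f ^ n) x
  rw [← pow_succ, ← pow_succ']

/-- A vector mapped by `f - a` into an `f`-invariant subspace is an eigenvector modulo it. -/
theorem pow_apply_sub_mem {f : X →L[ℂ] X} {p : Submodule ℂ X} (hp : ∀ x ∈ p, f x ∈ p)
    {a : ℂ} {x : X} (hx : shift f a x ∈ p) (k : ℕ) : (f ^ k) x - a ^ k • x ∈ p := by
  induction k with
  | zero => simp
  | succ k ih =>
    have h : (f ^ (k + 1)) x - a ^ (k + 1) • x =
        f ((f ^ k) x - a ^ k • x) + a ^ k • shift f a x := by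
      rw [map_sub, map_smul, shift_apply, smul_sub, smul_smul, ← pow_succ, pow_succ']
      change f ((f ^ k) x) - _ = _
      abel
    rw [h]
    exact p.add_mem (hp _ ih) (p.smul_mem _ hx)

theorem pow_apply_sub_mem_range_shift (f : X →L[ℂ] X) (a : ℂ) (x : X) (k : ℕ) :
    (f ^ k) x - a ^ k • x ∈ (shift f a).range := by
  induction k generalizing x with
  | zero => simp
  | succ k ih =>
    have h : (f ^ (k + 1)) x - a ^ (k + 1) • x =
        ((f ^ k) (f x) - a ^ k • f x) + a ^ k • shift f a x := by
      rw [shift_apply, smul_sub, smul_smul, ← pow_succ, pow_succ]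
      change (f ^ k) (f x) - _ = _
      abel
    rw [h]
    exact add_mem (ih _) (Submodule.smul_mem _ _ ⟨x, rfl⟩)

/-- If `(f - a) x` lies in `R(f ^ n)`, then `f ^ n x` is congruent to `a ^ n • x` modulo that range,
so `x` lies in it as `a ≠ 0`. Also `f ^ n x` is congruent to `a ^ n • x` modulo `R(f - a)`, so the
two ranges span `X`. Hence kernel and cokernel do not change under restriction. -/
theorem isWeyl_shift_restrictRange_iff [CompleteSpace X] {f : X →L[ℂ] X} {n : ℕ}
    (hn : IsClosed ((f ^ n).range : Set X)) {a : ℂ} (ha : a ≠ 0) :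
    (IsWeyl (shift f a) ↔ IsWeyl (shift (restrictRange f n) a)) ∧
      (Function.Injective (shift f a) ↔
        Function.Injective (shift (restrictRange f n) a)) := by
  have : CompleteSpace (f ^ n).range := hn.completeSpace_coe
  have hmem : ∀ x, shift f a x ∈ (f ^ n).range → x ∈ (f ^ n).range := by
    intro x hx
    have h := pow_apply_sub_mem (mapsTo_range_pow f n) hx n
    have h' : a ^ n • x ∈ (f ^ n).range := 
      (Submodule.sub_mem_iff_right _ (LinearMap.mem_range_self (f ^ n).toLinearMap x)).1 h
    exact (Submodule.smul_mem_iff _ (pow_ne_zero n ha)).1 h'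
  refine isWeyl_congr (i := (f ^ n).range.subtype) (j := (f ^ n).range.subtype)
    (Submodule.subtype_injective _) (Submodule.subtype_injective _) (fun x => rfl)
    (fun x hx => ⟨⟨x, hmem x ?_⟩, rfl⟩) (fun x => ?_)
    (fun y x hx => ⟨⟨x, hmem x ?_⟩, Subtype.ext hx⟩)
  · rw [hx]
    exact zero_mem _
  · obtain ⟨z, hz⟩ := pow_apply_sub_mem_range_shift f a x n
    refine ⟨(a ^ n)⁻¹ • ⟨(f ^ n) x, ⟨x, rfl⟩⟩, -(a ^ n)⁻¹ • z, ?_⟩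
    have hz' : shift f a z = (f ^ n) x - a ^ n • x := hz
    rw [map_smul, map_smul, hz', neg_smul, smul_sub, inv_smul_smul₀ (pow_ne_zero n ha)]
    change _ • (f ^ n) x + _ = x
    abel
  · rw [hx]
    exact y.2

theorem IsWeyl.isBWeyl [CompleteSpace X] {f : X →L[ℂ] X} (hf : IsWeyl f) : IsBWeyl f := by
  have hmem : ∀ x, x ∈ (f ^ 0).range := fun x => ⟨x, rfl⟩
  have hclosed : IsClosed ((f ^ 0).range : Set X) := by
    convert isClosed_univ
    exact Set.eq_univ_of_forall hmem
  have : CompleteSpace (f ^ 0).range := hclosed.completeSpace_coe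
  refine ⟨0, hclosed, (isWeyl_congr (f := f) (i := (f ^ 0).range.subtype)
    (j := (f ^ 0).range.subtype) (Submodule.subtype_injective _) (Submodule.subtype_injective _)
    (fun x => rfl) (fun x _ => ⟨⟨x, hmem x⟩, rfl⟩) (fun x => ⟨⟨x, hmem x⟩, 0, ?_⟩)
    (fun y x hx => ⟨⟨x, hmem x⟩, Subtype.ext hx⟩)).1.1 hf⟩
  rw [map_zero, add_zero]
  rfl

theorem finiteDimensional_ker_pow (f : X →L[ℂ] X) [FiniteDimensional ℂ f.ker] (n : ℕ) :
    FiniteDimensional ℂ (f ^ n).ker := by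
  induction n with
  | zero =>
    have : (f ^ 0).ker = ⊥ := LinearMap.ker_eq_bot.2 Function.injective_id
    rw [this]
    infer_instance
  | succ n ih =>
    have : (f ^ (n + 1)).ker = (f ^ n).ker.comap f.toLinearMap := rfl
    rw [this]
    infer_instance

/-- A B-Weyl operator with finite-dimensional kernel is Weyl. -/
theorem IsBWeyl.isWeyl [CompleteSpace X] {f : X →L[ℂ] X} (hf : IsBWeyl f)
    [FiniteDimensional ℂ f.ker] : IsWeyl f := by
  obtain ⟨n, hn, hw⟩ := hf
  have : CompleteSpace (f ^ n).range := hn.completeSpace_coe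
  obtain ⟨_, _, -⟩ := isWeyl_iff.1 hw
  have hfk := finiteDimensional_ker_pow f n
  set p := (f ^ n).toLinearMap.rangeRestrict with hp
  have hpr : p.range = ⊤ := LinearMap.range_rangeRestrict _
  have hpk : FiniteDimensional ℂ p.ker := by
    rw [hp, LinearMap.ker_rangeRestrict]
    exact hfk
  have hpc : FiniteDimensional ℂ (_ ⧸ p.range) := by
    rw [hpr]
    infer_instance
  -- The surjection `p : X → R(f ^ n)` induced by `f ^ n` has finite-dimensional kernel and
  -- intertwines `f` with its restriction.
  have hcomm : (restrictRange f n).toLinearMap ∘ₗ p = p ∘ₗ f.toLinearMap := by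
    ext x
    exact (pow_apply_comm f n x).symm
  have hcoker : FiniteDimensional ℂ (X ⧸ f.range) := by
    have : FiniteDimensional ℂ (_ ⧸ (p ∘ₗ f.toLinearMap).range) := by
      rw [← hcomm, LinearMap.range_comp]
      infer_instance
    have hle : f.range ≤ (p ∘ₗ f.toLinearMap).range.comap p := by
      rintro _ ⟨x, rfl⟩
      exact ⟨x, rfl⟩
    -- The cokernel of `f` is an extension of that of `p ∘ f` by the image of `p.ker`, both
    -- finite-dimensional.
    refine Module.Finite.of_exact (f := f.range.mkQ ∘ₗ p.ker.subtype)
      (g := f.range.mapQ _ p hle) ?_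
      (LinearMap.range_eq_top.1 (by rw [Submodule.range_mapQ, hpr, Submodule.map_top,
        Submodule.range_mkQ]))
    rw [LinearMap.exact_iff]
    ext q
    obtain ⟨x, rfl⟩ := Submodule.Quotient.mk_surjective _ q
    rw [LinearMap.mem_ker, Submodule.mapQ_apply, Submodule.Quotient.mk_eq_zero]
    constructor
    · rintro ⟨y, hy⟩
      refine ⟨⟨x - f y, ?_⟩, ?_⟩
      · rw [LinearMap.mem_ker, map_sub, ← hy]
        exact sub_self _
      · refine (Submodule.Quotient.eq _).2 ⟨-y, ?_⟩
        change f (-y) = x - f y - x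
        rw [map_neg]
        abel
    · rintro ⟨⟨z, hz⟩, hzx⟩
      obtain ⟨y, hy⟩ := (Submodule.Quotient.eq _).1 hzx
      refine ⟨-y, ?_⟩
      have hy' : f y = z - x := hy
      change p (f (-y)) = p x
      rw [map_neg, hy', neg_sub, map_sub, LinearMap.mem_ker.1 hz, sub_zero]
  -- The index of the common composite is computed in two ways; the index of `p` cancels, so `f` has
  -- the index of its restriction, which is `0`.
  have h1 := LinearMap.index_comp (f := p) (restrictRange f n).toLinearMap
  have h2 := LinearMap.index_comp (f := f.toLinearMap) p
  rw [hcomm, hw.2] at h1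
  exact ⟨isFredholm_of_finite f, by lia⟩

theorem IsBWeyl.bijective_of_injective [CompleteSpace X] {f : X →L[ℂ] X} (hf : IsBWeyl f)
    (hi : Function.Injective f) : Function.Bijective f := by
  have hk : f.ker = ⊥ := LinearMap.ker_eq_bot.2 hi
  have : FiniteDimensional ℂ f.ker := by
    rw [hk]
    infer_instance
  exact hf.isWeyl.bijective_of_injective hi

/-- Near a point outside the B-Weyl spectrum, either all other points are in the resolvent set, or
all other points are eigenvalues outside the Weyl spectrum. -/
theorem eventually_of_isBWeyl_shift [CompleteSpace X] {T : X →L[ℂ] X} {l : ℂ}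
    (hT : IsBWeyl (shift T l)) :
    (∀ᶠ m in 𝓝[≠] l, Function.Bijective (shift T m)) ∨
      ∀ᶠ m in 𝓝[≠] l, IsWeyl (shift T m) ∧ ¬ Function.Injective (shift T m) := by
  obtain ⟨n, hn, hw⟩ := hT
  have : CompleteSpace ((shift T l) ^ n).range := hn.completeSpace_coe
  have htend : Tendsto (fun m : ℂ => m - l) (𝓝[≠] l) (𝓝[≠] 0) := by
    refine tendsto_nhdsWithin_iff.2 ⟨?_, ?_⟩
    · refine Tendsto.mono_left ?_ nhdsWithin_le_nhds
      have : Continuous fun m : ℂ => m - l := by fun_prop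
      simpa using this.tendsto l
    · filter_upwards [self_mem_nhdsWithin] with m hm
      exact sub_ne_zero.2 hm
  have hshift : ∀ m, shift (shift T l) (m - l) = shift T m := fun m => by
    rw [shift_shift, add_sub_cancel]
  refine hw.eventually_shift.imp (fun h => ?_) fun h => ?_
  · filter_upwards [htend.eventually h, self_mem_nhdsWithin] with m hm hml
    have key := isWeyl_shift_restrictRange_iff hn (sub_ne_zero.2 hml)
    rw [hshift] at key
    exact (key.1.2 (isWeyl_of_bijective hm)).bijective_of_injective (key.2.2 hm.1)
  · filter_upwards [htend.eventually h, self_mem_nhdsWithin] with m hm hml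
    have key := isWeyl_shift_restrictRange_iff hn (sub_ne_zero.2 hml)
    rw [hshift] at key
    exact ⟨key.1.2 hm.1, fun hi => hm.2 (key.2.1 hi)⟩

end RestrictRange

/-! ### Spectra, isolated points and the properties -/

section Spectra

variable {X : Type*} [NormedAddCommGroup X] [NormedSpace ℂ X] {T : X →L[ℂ] X} {l : ℂ}

theorem mem_spectrum_iff [CompleteSpace X] :
    l ∈ spectrum ℂ T ↔ ¬ Function.Bijective (shift T l) := by
  have h : shift T l = -(algebraMap ℂ (X →L[ℂ] X) l - T) := by
    rw [neg_sub, Algebra.algebraMap_eq_smul_one]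
    rfl
  rw [spectrum.mem_iff, ← ContinuousLinearMap.isUnit_iff_bijective, h, IsUnit.neg_iff]

theorem mem_pointSpectrum_iff : l ∈ pointSpectrum T ↔ ¬ Function.Injective (shift T l) := by
  rw [injective_iff_map_eq_zero]
  push Not
  refine exists_congr fun x => ?_
  rw [shift_apply, sub_eq_zero, and_comm]

theorem pointSpectrum_subset_approxPointSpectrum :
    pointSpectrum T ⊆ approxPointSpectrum T := by
  rintro m ⟨x, hx, hT⟩ ε hε
  have hn : ‖x‖ ≠ 0 := norm_ne_zero_iff.2 hx
  refine ⟨(‖x‖⁻¹ : ℂ) • x, ?_, ?_⟩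
  · rw [norm_smul, norm_inv, Complex.norm_real, norm_norm, inv_mul_cancel₀ hn]
  · rw [map_smul, shift_apply, hT, sub_self, smul_zero, norm_zero]
    exact hε

theorem notMem_approxPointSpectrum_of_bijective [CompleteSpace X]
    (h : Function.Bijective (shift T l)) : l ∉ approxPointSpectrum T := by
  intro hl
  obtain ⟨u, hu⟩ := ContinuousLinearMap.isUnit_iff_bijective.2 h
  set G : X →L[ℂ] X := ↑u⁻¹
  have hG : ∀ x, G (shift T l x) = x := fun x => by
    rw [← hu]
    exact DFunLike.congr_fun u.inv_mul x
  -- The inverse gives `1 ≤ ‖G‖ * ‖(T - l) x‖`; the added `1` makes the constant positive without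
  -- asking whether `G` vanishes.
  obtain ⟨x, hx, hlt⟩ := hl (‖G‖ + 1)⁻¹ (by positivity)
  have h1 : (1 : ℝ) ≤ ‖G‖ * ‖shift T l x‖ := by
    rw [← hx]
    nth_rw 1 [← hG x]
    exact G.le_opNorm _
  have h2 : ‖shift T l x‖ * (‖G‖ + 1) < 1 := by
    rwa [← lt_div_iff₀ (by positivity), one_div]
  nlinarith [norm_nonneg (shift T l x)]

theorem mem_iso_approxPointSpectrum_of_eventually [CompleteSpace X] (hl : l ∈ pointSpectrum T)
    (h : ∀ᶠ m in 𝓝[≠] l, Function.Bijective (shift T m)) :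
    l ∈ iso (approxPointSpectrum T) := by
  refine ⟨pointSpectrum_subset_approxPointSpectrum hl, fun hacc => ?_⟩
  obtain ⟨m, hm, hb⟩ := ((accPt_iff_frequently_nhdsNE.1 hacc).and_eventually h).exists
  exact notMem_approxPointSpectrum_of_bijective hb hm

/-- A punctured neighbourhood inside `Ea T` would contain a nonempty open subset of the approximate
point spectrum, none of whose points is isolated. -/
theorem not_eventually_mem_Ea : ¬ ∀ᶠ m in 𝓝[≠] l, m ∈ Ea T := by
  intro h
  obtain ⟨V, hV, hlV, hsub⟩ := mem_nhdsWithin.1 h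
  have hopen : IsOpen (V ∩ {l}ᶜ) := hV.inter isOpen_compl_singleton
  obtain ⟨m, hm⟩ : (V ∩ {l}ᶜ).Nonempty :=
    Filter.nonempty_of_mem (f := 𝓝[≠] l)
      (inter_mem (mem_nhdsWithin_of_mem_nhds (hV.mem_nhds hlV)) self_mem_nhdsWithin)
  refine (hsub hm).1.2 (accPt_iff_frequently_nhdsNE.2 (Eventually.frequently ?_))
  filter_upwards [mem_nhdsWithin_of_mem_nhds (hopen.mem_nhds hm)] with x hx
  exact (hsub hx).1.1

theorem bWeylSpectrum_subset_weylSpectrum [CompleteSpace X] : bWeylSpectrum T ⊆ weylSpectrum T :=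
  fun _ hm hw => hm hw.isBWeyl

/-- The inclusion `h` excludes the non-injective case of the dichotomy, since there `Ea T` would
contain a punctured neighbourhood of `l`. -/
theorem mem_Ea_of_notMem_bWeylSpectrum [CompleteSpace X]
    (h : spectrum ℂ T \ weylSpectrum T ⊆ Ea T) (hl : l ∈ spectrum ℂ T)
    (hb : l ∉ bWeylSpectrum T) : l ∈ Ea T := by
  have hb : IsBWeyl (shift T l) := not_not.1 hb
  have hp : l ∈ pointSpectrum T := mem_pointSpectrum_iff.2 fun hi =>
    mem_spectrum_iff.1 hl (hb.bijective_of_injective hi)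
  refine ⟨?_, hp⟩
  rcases eventually_of_isBWeyl_shift hb with h1 | h2
  · exact mem_iso_approxPointSpectrum_of_eventually hp h1
  · refine absurd ?_ (not_eventually_mem_Ea (T := T) (l := l))
    filter_upwards [h2] with m hm
    exact h ⟨mem_spectrum_iff.2 fun hbij => hm.2 hbij.1, not_not.2 hm.1⟩

theorem bWeylSpectrum_eq_of_propertyZEa [CompleteSpace X] (h : PropertyZEa T) :
    bWeylSpectrum T = weylSpectrum T := by
  refine bWeylSpectrum_subset_weylSpectrum.antisymm fun m hw => ?_
  by_contra hb
  by_cases hm : m ∈ spectrum ℂ T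
  · have := mem_Ea_of_notMem_bWeylSpectrum h.subset hm hb
    rw [← h] at this
    exact this.2 hw
  · rw [mem_spectrum_iff, not_not] at hm
    exact hw (isWeyl_of_bijective hm)

theorem Ea_eq_Ea0_of_propertyZEa (h : PropertyZEa T) : Ea T = Ea0 T := by
  refine Set.Subset.antisymm (fun m hm => ?_) fun m hm => ⟨hm.1, hm.2.1⟩
  have hw : IsWeyl (shift T m) := by
    rw [← h] at hm
    exact not_not.1 hm.2
  exact ⟨hm.1, hm.2, hw.1.finite_ker⟩

/-- Points of `Ea0 T` have finite-dimensional eigenspaces, and for these B-Weyl implies Weyl. -/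
theorem propertyZEa_of_propertyBaw [CompleteSpace X] (h : PropertyBaw T) (hE : Ea T = Ea0 T) :
    PropertyZEa T := by
  refine Set.Subset.antisymm (fun m hm => ?_) fun m hm => ?_
  · rw [hE, ← h]
    exact ⟨hm.1, fun hb => hm.2 (bWeylSpectrum_subset_weylSpectrum hb)⟩
  · rw [hE] at hm
    have : FiniteDimensional ℂ (shift T m).ker := hm.2.2
    rw [← h] at hm
    exact ⟨hm.1, not_not.2 (not_not.1 hm.2 : IsBWeyl (shift T m)).isWeyl⟩

end Spectra

end WeylType

theorem theorem2 {X : Type*} [NormedAddCommGroup X] [NormedSpace ℂ X] [CompleteSpace X]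
    (hX : ¬ FiniteDimensional ℂ X) (T : X →L[ℂ] X) :
    List.TFAE
      [WeylType.PropertyZEa T,
       WeylType.PropertyGaw T ∧ WeylType.bWeylSpectrum T = WeylType.weylSpectrum T,
       WeylType.PropertyAw T ∧ WeylType.Ea T = WeylType.Ea0 T,
       WeylType.PropertyBaw T ∧ WeylType.Ea T = WeylType.Ea0 T] := by
  tfae_have 1 → 2 := fun h => by
    have hb := WeylType.bWeylSpectrum_eq_of_propertyZEa h
    exact ⟨by rw [WeylType.PropertyGaw, hb]; exact h, hb⟩
  tfae_have 2 → 1 := fun ⟨h, hb⟩ => by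
    rw [WeylType.PropertyGaw, hb] at h
    exact h
  tfae_have 1 → 3 := fun h => by
    have hE := WeylType.Ea_eq_Ea0_of_propertyZEa h
    exact ⟨by rw [WeylType.PropertyAw, ← hE]; exact h, hE⟩
  tfae_have 3 → 1 := fun ⟨h, hE⟩ => by
    rw [WeylType.PropertyAw, ← hE] at h
    exact h
  tfae_have 1 → 4 := fun h => by
    have hE := WeylType.Ea_eq_Ea0_of_propertyZEa h
    have hb := WeylType.bWeylSpectrum_eq_of_propertyZEa h
    exact ⟨by rw [WeylType.PropertyBaw, hb, ← hE]; exact h, hE⟩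
  tfae_have 4 → 1 := fun ⟨h, hE⟩ => WeylType.propertyZEa_of_propertyBaw h hE
  tfae_finish
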